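/- There is a universal constant $0<C\le 570$ such that the following holds. Let $(p_i)_{i\ge 1}$ be a non-increasing sequence in $(0,1)$ with $\sum_{i\ge1}p_i^2=\sigma^2<\infty$, where $\sigma\ge 0$. Let $b_s=\mathfrak e_s(\{p_1,p_2,\ldots\}')$ be the image of the elementary symmetric function $\mathfrak e_s$ under the morphism of real algebras $\mathrm{Sym}=\mathbb R[\mathfrak p_1,\mathfrak p_2,\ldots]\to\mathbb R$ that sends the power sum $\mathfrak p_1$ to $0$ and $\mathfrak p_k$ to $\sum_{i\ge1}p_i^k$ for each $k\ge2$; here $\mathfrak e_0=1$ and $s\,\mathfrak e_s=\sum_{i=0}^{s-1}(-1)^{s-1-i}\,\mathfrak e_i\,\mathfrak p_{s-i}$ for $s\ge 1$. Let $n\ge 0$ and $r\ge1$ be integers, and set $$\lambda_n=\sum_{i=1}^n p_i,\qquad r_n=\sum_{i>n}p_i^2.$$ Assume that $\lambda_n>16\,\mathrm e\,\sigma^2$, and set $\eta_n=\dfrac{4\sqrt{\mathrm e}\,\sigma}{\sqrt{\lambda_n}}$. Let $\mu_n$ be the law of $X_n=\sum_{i=1}^nY_i$, where $Y_1,\ldots,Y_n$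 are independent Bernoulli random variables with $\mathbb P[Y_i=1]=p_i=1-\mathbb P[Y_i=0]$. Then there is exactly one finite signed measure $\nu_{n,*}^{(r)}$ on $\mathbb N$ (the derived approximation scheme of order $r$) such that, for every $\xi\in\mathbb R$, $$\sum_{k\ge0}\nu_{n,*}^{(r)}(\{k\})\,\mathrm e^{\mathrm ik\xi}=\mathrm e^{\lambda_n(\mathrm e^{\mathrm i\xi}-1)}\Bigl(1+\sum_{s=2}^r b_s\,(\mathrm e^{\mathrm i\xi}-1)^s\Bigr),$$ and $$\frac12\sum_{k\ge0}\bigl|\mu_n(\{k\})-\nu_{n,*}^{(r)}(\{k\})\bigr|\;\le\; C\,\eta_n^{\,r+1}+\bigl(r^2+(2\lambda_n+1)\,r\bigr)\Bigl(\sum_{s=2}^r(2\sigma)^{s-2}\Bigr)\,r_n .$$ -/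

import Mathlib

open MeasureTheory ProbabilityTheory

/-- The real algebra of symmetric functions in infinitely many variables, presented on its
algebraic basis of Newton power sums: it is `ℝ[𝔭₁, 𝔭₂, …]`. -/
abbrev SymFun : Type := MvPolynomial ℕ+ ℝ

namespace SymFun

/-- The power sum `𝔭ₖ`, for `k ≥ 1`. -/
noncomputable def powerSum (k : ℕ+) : SymFun := MvPolynomial.X k

/-- The elementary symmetric function `𝔢ₛ` as a polynomial in the power sums, given by Newton's
identities `(s + 1) 𝔢ₛ₊₁ = ∑_{i=0}^{s} (-1)^(s-i) 𝔢ᵢ 𝔭ₛ₊₁₋ᵢ`, that is, by the generating series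
`∑ₛ 𝔢ₛ zˢ = exp (∑_{k ≥ 1} (-1)^(k-1) 𝔭ₖ zᵏ / k)`. The theorem `aeval_psum_elem` below checks that
in any finite set of variables this is the usual elementary symmetric polynomial. -/
noncomputable def elem : ℕ → SymFun
  | 0 => 1
  | s + 1 => MvPolynomial.C (1 / ((s : ℝ) + 1)) *
      ∑ i : Fin (s + 1), (-1) ^ (s - (i : ℕ)) * elem i * powerSum (s - (i : ℕ)).succPNat

theorem aeval_psum_elem (τ : Type*) [Fintype τ] (s : ℕ) :
    MvPolynomial.aeval (fun k : ℕ+ => MvPolynomial.psum τ ℝ k) (elem s) =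
      MvPolynomial.esymm τ ℝ s := by
  induction s using Nat.strong_induction_on with
  | _ s ih =>
    cases s with
    | zero => simp [elem]
    | succ s =>
      have h1 : ((s : ℝ) + 1) ≠ 0 := by positivity
      have key := MvPolynomial.mul_esymm_eq_sum τ ℝ (s + 1)
      have hfil : ((Finset.HasAntidiagonal.antidiagonal (s + 1)).filter fun a : ℕ × ℕ => a.1 < s + 1) =
          (Finset.range (s + 1)).image fun i => (i, s + 1 - i) := by
        ext ⟨a, b⟩
        simp only [Finset.mem_filter, Finset.HasAntidiagonal.mem_antidiagonal, Finset.mem_image,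
          Finset.mem_range, Prod.mk.injEq]
        constructor
        · rintro ⟨h, h'⟩
          exact ⟨a, h', rfl, by omega⟩
        · rintro ⟨i, hi, rfl, rfl⟩
          exact ⟨by omega, hi⟩
      rw [hfil, Finset.sum_image (fun i _ j _ hij => congrArg Prod.fst hij), Finset.mul_sum,
        ← Fin.sum_univ_eq_sum_range
          (fun i => (-1 : MvPolynomial τ ℝ) ^ (s + 1 + 1) * ((-1) ^ i *
            MvPolynomial.esymm τ ℝ i * MvPolynomial.psum τ ℝ (s + 1 - i))) (s + 1)] at key
      have hsum : MvPolynomial.aeval (fun k : ℕ+ => MvPolynomial.psum τ ℝ k)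
          (∑ i : Fin (s + 1), (-1) ^ (s - (i : ℕ)) * elem i *
            powerSum (s - (i : ℕ)).succPNat) =
          ((s + 1 : ℕ) : MvPolynomial τ ℝ) * MvPolynomial.esymm τ ℝ (s + 1) := by
        rw [key, map_sum]
        refine Finset.sum_congr rfl fun i _ => ?_
        have hi : (i : ℕ) ≤ s := Nat.lt_succ_iff.mp i.2
        have e1 : (-1 : MvPolynomial τ ℝ) ^ (s + 1 + 1) * (-1) ^ (i : ℕ) =
            (-1) ^ (s - (i : ℕ)) := by
          obtain ⟨d, hd⟩ := Nat.exists_eq_add_of_le hi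
          rw [← pow_add, show s - (i : ℕ) = d by omega,
            show s + 1 + 1 + (i : ℕ) = d + 2 * (i + 1) by omega, pow_add, pow_mul]
          simp
        have e2 : s - (i : ℕ) + 1 = s + 1 - i := by omega
        rw [map_mul, map_mul, ih i i.2, powerSum, MvPolynomial.aeval_X, Nat.succPNat_coe,
          Nat.succ_eq_add_one, e2, map_pow, map_neg, map_one, ← e1]
        ring
      rw [elem, map_mul, hsum, MvPolynomial.aeval_C, MvPolynomial.algebraMap_eq,
        ← mul_assoc, ← map_natCast (MvPolynomial.C (σ := τ) (R := ℝ)), ← map_mul]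
      push_cast
      rw [one_div_mul_cancel h1, map_one, one_mul]

/-- The specialisation `f ↦ f(A')` of the algebra of symmetric functions attached to a
square-summable sequence `A = (a₀, a₁, …)`: it is the morphism of algebras with
`𝔭₁(A') = 0` and `𝔭ₖ(A') = ∑ᵢ aᵢᵏ` for `k ≥ 2`. -/
noncomputable def virtualAlphabet (a : ℕ → ℝ) : SymFun →ₐ[ℝ] ℝ :=
  MvPolynomial.aeval fun k : ℕ+ => if k = 1 then 0 else ∑' i, a i ^ (k : ℕ)

end SymFun

/-- `ν` is the signed measure on `ℕ` with Fourier transform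
`∑ₖ ν({k}) e^{ikξ} = e^{lam (e^{iξ} - 1)} (1 + ∑_{s=2}^r bₛ (e^{iξ} - 1)ˢ)`. -/
def IsPoissonScheme (lam : ℝ) (b : ℕ → ℝ) (r : ℕ) (ν : SignedMeasure ℕ) : Prop :=
  ∀ ξ : ℝ, HasSum (fun k : ℕ => (ν {k} : ℂ) * Complex.exp (Complex.I * k * ξ))
    (Complex.exp (lam * (Complex.exp (Complex.I * ξ) - 1)) *
      (1 + ∑ s ∈ Finset.Icc 2 r, (b s : ℂ) * (Complex.exp (Complex.I * ξ) - 1) ^ s))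

/-- `ν` is the derived approximation scheme of order `r` of the law of a sum of `n` independent
Bernoulli variables with parameters `p₀, …, pₙ₋₁`: its Poisson parameter is
`p₀ + ⋯ + pₙ₋₁` and its coefficients `bₛ = 𝔢ₛ({p₀, p₁, …}')` are computed from the
whole infinite sequence. -/
def IsDerivedScheme (p : ℕ → ℝ) (n r : ℕ) (ν : SignedMeasure ℕ) : Prop :=
  IsPoissonScheme (∑ i ∈ Finset.range n, p i)
    (fun s => SymFun.virtualAlphabet p (SymFun.elem s)) r ν

/-- The total variation distance `½ ∑ₖ |μ({k}) - ν({k})|` of a positive and a signed measure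
on `ℕ`. -/
noncomputable def dTV (μ : Measure ℕ) (ν : SignedMeasure ℕ) : ℝ :=
  1 / 2 * ∑' k : ℕ, |μ.real {k} - ν {k}|

/-- The series that defines `dTV μ ν` converges for a finite measure `μ`. -/
theorem summable_dTV (μ : Measure ℕ) [IsFiniteMeasure μ] (ν : SignedMeasure ℕ) :
    Summable fun k : ℕ => |μ.real {k} - ν {k}| := by
  have h := (VectorMeasure.hasSum_of_disjoint_iUnion (v := μ.toSignedMeasure - ν)
    (f := fun k : ℕ => ({k} : Set ℕ)) (fun _ => MeasurableSet.singleton _)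
    (fun i j hij => by simpa using hij)).summable.abs
  simpa using h

/-! Put `z = w - 1` and `lam = λ_n`. The generating function of the law is `∏ (1 + pᵢ z) = e^{lam z}
∏ (1 + pᵢ z) e^{-pᵢ z} = e^{lam z} ∑ cₛ zˢ`, where `cₛ` is the elementary symmetric function of the
first `n` letters with `𝔭₁` set to `0`. Since `e^{lam z} zˢ` generates the `s`-th difference `Dₛ` of
the Poisson law, law and scheme are both combinations of the `Dₛ`, and the error is at most `½ ∑ₛ
|cₛ - bₛ 1_{s ≤ r}| ‖Dₛ‖₁`, with `b₀ = 1` and `b₁ = 0`.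

Two bounds on `‖Dₛ‖₁` are used: `2ˢ`, and `√(s!/lamˢ)`, which is Cauchy-Schwarz applied to the
Charlier polynomials. For `s > r`, the majorant `∑ |cₛ| Rˢ ≤ exp(σ²R²)` with optimal `R` gives `|cₛ|
≤ (2eσ²/s)^{s/2}`. As `s! ≤ sˢ`, the second bound makes the `s`-th term at most `(η/2)ˢ`, a
geometric tail (`abs_finiteCoeff_mul_le`). For `2 ≤ s ≤ r`, the tail of the sequence is an alphabet
of size `√r_n` with vanishing `𝔭₁`, so it moves the coefficient by at most `(s-1) r_n σ^{s-2}`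
(`abs_finiteCoeff_sub_le`), and the first bound suffices. -/

namespace SymFun

/-! ### Formal generating series of elementary symmetric functions. -/

open PowerSeries

/-- The generating series `∑ₛ 𝔢ₛ zˢ` of the elementary symmetric functions, specialised by
`𝔭ₖ ↦ q k`. -/
noncomputable def elemSeries (q : ℕ+ → ℝ) : ℝ⟦X⟧ := .mk fun s => MvPolynomial.aeval q (elem s)

/-- The generating series `∑ₖ (-1)ᵏ 𝔭ₖ₊₁ zᵏ` of the power sums, specialised by `𝔭ₖ ↦ q k`. -/
noncomputable def powerSumSeries (q : ℕ+ → ℝ) : ℝ⟦X⟧ := .mk fun k => (-1) ^ k * q k.succPNat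

theorem aeval_elem_succ (q : ℕ+ → ℝ) (s : ℕ) :
    ((s : ℝ) + 1) * MvPolynomial.aeval q (elem (s + 1)) =
      ∑ i ∈ Finset.range (s + 1),
        (-1) ^ (s - i) * MvPolynomial.aeval q (elem i) * q (s - i).succPNat := by
  have h1 : ((s : ℝ) + 1) ≠ 0 := by positivity
  rw [elem, map_mul, MvPolynomial.aeval_C, map_sum, ← mul_assoc]
  simp only [Algebra.algebraMap_self, RingHom.id_apply, map_mul, map_pow, map_neg, map_one,
    powerSum, MvPolynomial.aeval_X]
  rw [mul_one_div_cancel h1, one_mul, Fin.sum_univ_eq_sum_range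
    (fun i => (-1 : ℝ) ^ (s - i) * MvPolynomial.aeval q (elem i) * q (s - i).succPNat)]

@[simp] theorem constantCoeff_elemSeries (q : ℕ+ → ℝ) : constantCoeff (elemSeries q) = 1 := by
  rw [← coeff_zero_eq_constantCoeff_apply, elemSeries, coeff_mk, elem, map_one]

/-- Newton's identities are this differential equation read coefficientwise. It characterises the
series, which lets later identities be checked without a formal logarithm. -/
theorem derivative_elemSeries (q : ℕ+ → ℝ) :
    d⁄dX ℝ (elemSeries q) = elemSeries q * powerSumSeries q := by
  ext s
  rw [coeff_derivative, coeff_mul, Finset.Nat.sum_antidiagonal_eq_sum_range_succ_mk,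
    elemSeries, coeff_mk, mul_comm, aeval_elem_succ]
  refine Finset.sum_congr rfl fun i _ => ?_
  rw [powerSumSeries, coeff_mk, coeff_mk]
  ring

/-- A formal linear differential equation `A' = A * P` has at most one solution with given
constant coefficient. -/
theorem _root_.PowerSeries.eq_of_derivative_eq_mul {A B P : ℝ⟦X⟧}
    (h : constantCoeff A = constantCoeff B)
    (hA : d⁄dX ℝ A = A * P) (hB : d⁄dX ℝ B = B * P) : A = B := by
  ext s
  induction s using Nat.strong_induction_on with
  | _ s ih =>
    cases s with
    | zero => simpa using h
    | succ s =>
      have hA' := congrArg (coeff s) hA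
      have hB' := congrArg (coeff s) hB
      rw [coeff_derivative, coeff_mul] at hA' hB'
      have h1 : ((s : ℝ) + 1) ≠ 0 := by positivity
      refine mul_right_cancel₀ h1 ?_
      rw [hA', hB']
      refine Finset.sum_congr rfl fun x hx => ?_
      rw [Finset.HasAntidiagonal.mem_antidiagonal] at hx
      rw [ih x.1 (by omega)]

theorem powerSumSeries_add (q q' : ℕ+ → ℝ) :
    powerSumSeries (q + q') = powerSumSeries q + powerSumSeries q' := by
  ext k
  simp [powerSumSeries, mul_add]

/-- Adding power sums is taking the union of alphabets. Both sides solve the same linear equation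
because `powerSumSeries` is additive. -/
theorem elemSeries_add (q q' : ℕ+ → ℝ) :
    elemSeries (q + q') = elemSeries q * elemSeries q' := by
  refine eq_of_derivative_eq_mul (by simp) (derivative_elemSeries _) ?_
  rw [Derivation.leibniz, derivative_elemSeries, derivative_elemSeries, powerSumSeries_add,
    smul_eq_mul, smul_eq_mul]
  ring

theorem elemSeries_zero : elemSeries 0 = 1 := by
  refine eq_of_derivative_eq_mul (by simp) (derivative_elemSeries _) ?_
  have : powerSumSeries 0 = 0 := by
    ext k
    simp [powerSumSeries]
  simp [this]

theorem elemSeries_sum {ι : Type*} (t : Finset ι) (q : ι → ℕ+ → ℝ) :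
    elemSeries (∑ i ∈ t, q i) = ∏ i ∈ t, elemSeries (q i) := by
  classical
  induction t using Finset.induction_on with
  | empty => simpa using elemSeries_zero
  | insert a t ha ih => rw [Finset.sum_insert ha, Finset.prod_insert ha, elemSeries_add, ih]

/-- The power sums of the alphabet `{a}'`. -/
noncomputable def singlePowerSum (a : ℝ) (k : ℕ+) : ℝ := if k = 1 then 0 else a ^ (k : ℕ)

/-- Setting `𝔭₁` to `0` removes the linear term of `log (1 + az)`, hence the factor `e^{-az}`. -/
theorem elemSeries_singlePowerSum (a : ℝ) :
    elemSeries (singlePowerSum a) = (1 + C a * X) * rescale (-a) (exp ℝ) := by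
  have hexp : d⁄dX ℝ (rescale (-a) (exp ℝ)) = C (-a) * rescale (-a) (exp ℝ) := by
    ext k
    rw [coeff_derivative, coeff_C_mul, coeff_rescale, coeff_rescale, coeff_exp, coeff_exp,
      Nat.factorial_succ]
    simp only [eq_ratCast]
    push_cast
    have : ((k : ℝ) + 1) ≠ 0 := by positivity
    have : (k.factorial : ℝ) ≠ 0 := by positivity
    field_simp
    ring
  have h0 : Nat.succPNat 0 = 1 := rfl
  -- The power sum series is geometric, `-a²z / (1 + az)`; the denominator is cleared to stay with
  -- formal series.
  have hP : (1 + C a * X) * powerSumSeries (singlePowerSum a) = - (C a * C a * X) := by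
    ext k
    rw [add_mul, one_mul, map_add, mul_assoc, coeff_C_mul, map_neg, mul_assoc, coeff_C_mul,
      coeff_C_mul, mul_comm X, coeff_X]
    cases k with
    | zero => simp [powerSumSeries, singlePowerSum, h0]
    | succ k =>
      rw [coeff_succ_mul_X]
      cases k with
      | zero =>
        have : (Nat.succPNat 1) ≠ 1 := by decide
        simp [powerSumSeries, singlePowerSum, this, h0]
        ring
      | succ k =>
        have h1 : (Nat.succPNat (k + 1)) ≠ 1 := by
          simp [← PNat.coe_inj]
        have h2 : (Nat.succPNat (k + 1 + 1)) ≠ 1 := by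
          simp [← PNat.coe_inj]
        simp [powerSumSeries, singlePowerSum, h1, h2]
        ring
  have hc : constantCoeff (rescale (-a) (exp ℝ)) = 1 := by
    rw [← coeff_zero_eq_constantCoeff_apply, coeff_rescale, coeff_exp]
    simp
  refine eq_of_derivative_eq_mul (by simp [hc]) (derivative_elemSeries _) ?_
  rw [Derivation.leibniz, hexp, mul_right_comm, hP, map_add, Derivation.leibniz]
  simp
  ring

theorem coeff_elemSeries_singlePowerSum (a : ℝ) (k : ℕ) :
    coeff k (elemSeries (singlePowerSum a)) = (-a) ^ k * (1 - k) / k.factorial := by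
  rw [elemSeries_singlePowerSum, add_mul, one_mul, map_add, mul_assoc, coeff_C_mul, mul_comm X]
  cases k with
  | zero => simp
  | succ k =>
    rw [coeff_succ_mul_X, coeff_rescale, coeff_rescale, coeff_exp, coeff_exp,
      Nat.factorial_succ]
    simp only [eq_ratCast]
    push_cast
    have : ((k : ℝ) + 1) ≠ 0 := by positivity
    have : (k.factorial : ℝ) ≠ 0 := by positivity
    field_simp
    ring

theorem coeff_elemSeries_succ (q : ℕ+ → ℝ) (s : ℕ) :
    ((s : ℝ) + 1) * coeff (s + 1) (elemSeries q) =
      ∑ i ∈ Finset.range (s + 1), (-1) ^ (s - i) * coeff i (elemSeries q) * q (s - i).succPNat := by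
  simpa only [elemSeries, coeff_mk] using aeval_elem_succ q s

theorem coeff_one_elemSeries (q : ℕ+ → ℝ) : coeff 1 (elemSeries q) = q 1 := by
  have h := coeff_elemSeries_succ q 0
  have h1 : Nat.succPNat 0 = 1 := rfl
  simpa [h1] using h

/-- Newton's recursion makes `𝔢ₛ₊₁` an average of `s + 1` signed terms, each of size at most
`τ^(s+1)` by induction. -/
theorem abs_coeff_elemSeries_le {q : ℕ+ → ℝ} {τ : ℝ} (hτ : 0 ≤ τ)
    (hq : ∀ k : ℕ+, |q k| ≤ τ ^ (k : ℕ)) (s : ℕ) : |coeff s (elemSeries q)| ≤ τ ^ s := by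
  induction s using Nat.strong_induction_on with
  | _ s ih =>
    cases s with
    | zero => simp
    | succ s =>
      have h1 : (0 : ℝ) < (s : ℝ) + 1 := by positivity
      refine le_of_mul_le_mul_left ?_ h1
      rw [← abs_of_pos h1, ← abs_mul, coeff_elemSeries_succ, abs_of_pos h1]
      refine (Finset.abs_sum_le_sum_abs _ _).trans ?_
      refine (Finset.sum_le_card_nsmul _ _ (τ ^ (s + 1)) fun i hi => ?_).trans (by simp)
      have hi' : i < s + 1 := Finset.mem_range.mp hi
      rw [abs_mul, abs_mul, abs_pow, abs_neg, abs_one, one_pow, one_mul]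
      refine (mul_le_mul (ih i hi') (hq _) (abs_nonneg _) (by positivity)).trans (le_of_eq ?_)
      rw [← pow_add, Nat.succPNat_coe]
      congr 1
      omega

/-- Adding a small alphabet `B` with `𝔭₁(B) = 0` to an alphabet changes the elementary symmetric
functions by an amount quadratic in the size of `B`. -/
theorem abs_coeff_elemSeries_add_sub_le {q q' : ℕ+ → ℝ} {σ τ : ℝ} (hτ : 0 ≤ τ) (hτσ : τ ≤ σ)
    (hq : ∀ k : ℕ+, |q k| ≤ σ ^ (k : ℕ)) (hq' : ∀ k : ℕ+, |q' k| ≤ τ ^ (k : ℕ)) (h1 : q' 1 = 0)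
    (s : ℕ) :
    |coeff (s + 2) (elemSeries (q + q')) - coeff (s + 2) (elemSeries q)| ≤
      (s + 1) * τ ^ 2 * σ ^ s := by
  have hσ := hτ.trans hτσ
  -- In the convolution the top term cancels against `𝔢ₛ₊₂` of the original alphabet and the next
  -- one vanishes because `𝔢₁ = 𝔭₁ = 0` on the added alphabet. Each of the `s + 1` remaining terms
  -- carries a factor `τ²`.
  rw [elemSeries_add, coeff_mul, Finset.Nat.sum_antidiagonal_eq_sum_range_succ_mk,
    Finset.sum_range_succ, Finset.sum_range_succ]
  have e1 : s + 2 - (s + 1) = 1 := by omega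
  simp only [e1, coeff_one_elemSeries, h1, mul_zero, add_zero, Nat.sub_self,
    coeff_zero_eq_constantCoeff_apply, constantCoeff_elemSeries, mul_one, add_sub_cancel_right]
  refine (Finset.abs_sum_le_sum_abs _ _).trans ?_
  refine (Finset.sum_le_card_nsmul _ _ (τ ^ 2 * σ ^ s) fun i hi => ?_).trans
    (le_of_eq (by rw [Finset.card_range, nsmul_eq_mul]; push_cast; ring))
  have hi' : i < s + 1 := Finset.mem_range.mp hi
  obtain ⟨d, rfl⟩ := Nat.exists_eq_add_of_le (Nat.lt_succ_iff.mp hi')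
  have e2 : i + d + 2 - i = d + 2 := by omega
  rw [abs_mul, e2]
  calc |coeff i (elemSeries q)| * |coeff (d + 2) (elemSeries q')|
      ≤ σ ^ i * τ ^ (d + 2) := mul_le_mul (abs_coeff_elemSeries_le hσ hq i)
        (abs_coeff_elemSeries_le hτ hq' _) (abs_nonneg _) (by positivity)
    _ = τ ^ 2 * (σ ^ i * τ ^ d) := by ring
    _ ≤ τ ^ 2 * (σ ^ i * σ ^ d) := by gcongr
    _ = τ ^ 2 * σ ^ (i + d) := by ring

/-- The power sums of the alphabet `A'`, for `A` a square-summable sequence. -/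
noncomputable def virtualPowerSum (a : ℕ → ℝ) (k : ℕ+) : ℝ := if k = 1 then 0 else ∑' i, a i ^ (k : ℕ)

theorem virtualAlphabet_elem (a : ℕ → ℝ) (s : ℕ) :
    virtualAlphabet a (elem s) = coeff s (elemSeries (virtualPowerSum a)) := by
  rw [elemSeries, coeff_mk]
  rfl

/-- Every `aᵢ` is at most the `ℓ²` norm `τ`, so `aᵢ^(k+2) ≤ τᵏ aᵢ²`. -/
theorem summable_pow_of_sq {a : ℕ → ℝ} (ha : ∀ i, 0 ≤ a i)
    (hs : Summable fun i => a i ^ 2) (k : ℕ) :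
    (Summable fun i => a i ^ (k + 2)) ∧ ∑' i, a i ^ (k + 2) ≤ √(∑' i, a i ^ 2) ^ (k + 2) := by
  set τ := √(∑' i, a i ^ 2) with hτ
  have hτ2 : τ ^ 2 = ∑' i, a i ^ 2 := Real.sq_sqrt (tsum_nonneg fun i => sq_nonneg _)
  have hle : ∀ i, a i ≤ τ := fun i =>
    Real.le_sqrt_of_sq_le (hs.le_tsum i fun j _ => sq_nonneg _)
  have hb : ∀ i, a i ^ (k + 2) ≤ τ ^ k * a i ^ 2 := fun i => by
    rw [pow_add]
    exact mul_le_mul_of_nonneg_right (pow_le_pow_left₀ (ha i) (hle i) k) (sq_nonneg _)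
  have hsum : Summable fun i => a i ^ (k + 2) :=
    Summable.of_nonneg_of_le (fun i => pow_nonneg (ha i) _) hb (hs.mul_left _)
  refine ⟨hsum, (hsum.tsum_le_tsum hb (hs.mul_left _)).trans (le_of_eq ?_)⟩
  rw [tsum_mul_left, ← hτ2]
  ring

theorem _root_.PNat.exists_eq_add_two {k : ℕ+} (hk : k ≠ 1) : ∃ m : ℕ, (k : ℕ) = m + 2 := by
  have h1 : (k : ℕ) ≠ 1 := fun h => hk (PNat.coe_eq_one_iff.mp h)
  exact ⟨k - 2, by have := k.pos; omega⟩

theorem abs_virtualPowerSum_le {a : ℕ → ℝ} (ha : ∀ i, 0 ≤ a i)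
    (hs : Summable fun i => a i ^ 2) (k : ℕ+) :
    |virtualPowerSum a k| ≤ √(∑' i, a i ^ 2) ^ (k : ℕ) := by
  rw [virtualPowerSum]
  split_ifs with hk
  · rw [abs_zero]
    positivity
  · obtain ⟨m, hm⟩ := PNat.exists_eq_add_two hk
    rw [hm, abs_of_nonneg (tsum_nonneg fun i => pow_nonneg (ha i) _)]
    exact (summable_pow_of_sq ha hs m).2

/-- Splits the infinite alphabet into its first `n` letters, which govern the law, and a tail
treated as a perturbation. -/
theorem virtualPowerSum_eq_add {a : ℕ → ℝ} (ha : ∀ i, 0 ≤ a i)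
    (hs : Summable fun i => a i ^ 2) (n : ℕ) :
    virtualPowerSum a = ∑ i ∈ Finset.range n, singlePowerSum (a i) +
      virtualPowerSum fun i => a (n + i) := by
  funext k
  rw [Pi.add_apply, Finset.sum_apply]
  simp only [virtualPowerSum, singlePowerSum]
  split_ifs with hk
  · simp
  · obtain ⟨m, hm⟩ := PNat.exists_eq_add_two hk
    rw [hm, ← (summable_pow_of_sq ha hs m).1.sum_add_tsum_nat_add n]
    simp only [add_comm n]

theorem abs_sum_singlePowerSum_le {a : ℕ → ℝ} (ha : ∀ i, 0 ≤ a i)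
    (hs : Summable fun i => a i ^ 2) (n : ℕ) (k : ℕ+) :
    |(∑ i ∈ Finset.range n, singlePowerSum (a i)) k| ≤ √(∑' i, a i ^ 2) ^ (k : ℕ) := by
  rw [Finset.sum_apply]
  simp only [singlePowerSum]
  split_ifs with hk
  · rw [Finset.sum_const_zero, abs_zero]
    positivity
  · obtain ⟨m, hm⟩ := PNat.exists_eq_add_two hk
    rw [hm, abs_of_nonneg (Finset.sum_nonneg fun i _ => pow_nonneg (ha i) _)]
    obtain ⟨h1, h2⟩ := summable_pow_of_sq ha hs m
    exact (h1.sum_le_tsum _ fun i _ => pow_nonneg (ha i) _).trans h2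

end SymFun

/-! ### Convergence and majorants of the generating series. -/

namespace SymFun

open PowerSeries

theorem hasSum_pow_div_factorial (u : ℂ) : HasSum (fun k : ℕ => u ^ k / k.factorial) (Complex.exp u) := by
  rw [Complex.exp_eq_exp_ℂ]
  exact NormedSpace.expSeries_div_hasSum_exp u

theorem hasSum_pow_div_factorial_mul (u : ℂ) :
    HasSum (fun k : ℕ => u ^ k / k.factorial * k) (u * Complex.exp u) := by
  rw [← hasSum_nat_add_iff' 1]
  simp only [Finset.range_one, Finset.sum_singleton, Nat.cast_zero, mul_zero, sub_zero]
  refine ((hasSum_pow_div_factorial u).mul_left u).congr_fun fun k => ?_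
  rw [Nat.factorial_succ]
  push_cast
  have : ((k : ℂ) + 1) ≠ 0 := by exact_mod_cast Nat.succ_ne_zero k
  have : (k.factorial : ℂ) ≠ 0 := by exact_mod_cast k.factorial_ne_zero
  field_simp
  ring

theorem hasSum_coeff_elemSeries_singlePowerSum (a : ℝ) (z : ℂ) :
    HasSum (fun k => ((coeff k (elemSeries (singlePowerSum a)) : ℝ) : ℂ) * z ^ k)
      ((1 + a * z) * Complex.exp (-(a * z))) := by
  have h := (hasSum_pow_div_factorial (-(a * z))).sub (hasSum_pow_div_factorial_mul (-(a * z)))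
  convert! h using 1
  · funext k
    rw [coeff_elemSeries_singlePowerSum, ← neg_mul, mul_pow]
    push_cast
    ring
  · ring

/-- The left side is the absolute majorant of `(1 - v) e^v`. The difference of the two sides
vanishes at `0` and has derivative `x (2 e^{x²} - e^x)`, which is nonnegative because `x ≤ x² + 1/4`
and `e^{1/4} ≤ 2`. -/
theorem two_add_sub_one_mul_exp_le {v : ℝ} (hv : 0 ≤ v) :
    2 + (v - 1) * Real.exp v ≤ Real.exp (v ^ 2) := by
  have hd : ∀ x : ℝ, HasDerivAt (fun x => Real.exp (x ^ 2) - (2 + (x - 1) * Real.exp x))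
      (x * (2 * Real.exp (x ^ 2) - Real.exp x)) x := fun x => by
    have h1 := (hasDerivAt_pow 2 x).exp
    have h2 := (((hasDerivAt_id' x).sub_const 1).mul (Real.hasDerivAt_exp x)).const_add 2
    refine (h1.sub h2).congr_deriv ?_
    simp
    ring
  have hmono : MonotoneOn (fun x => Real.exp (x ^ 2) - (2 + (x - 1) * Real.exp x)) (Set.Ici 0) := by
    refine monotoneOn_of_deriv_nonneg (convex_Ici 0)
      (fun x _ => (hd x).continuousAt.continuousWithinAt)
      (fun x _ => (hd x).differentiableAt.differentiableWithinAt) fun x hx => ?_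
    rw [interior_Ici, Set.mem_Ioi] at hx
    rw [(hd x).deriv]
    refine mul_nonneg hx.le ?_
    have h2 : Real.exp (1 / 4) ≤ 2 := by
      rw [← Real.le_log_iff_exp_le (by norm_num)]
      linarith [Real.log_two_gt_d9]
    have h3 : Real.exp x ≤ Real.exp (1 / 4) * Real.exp (x ^ 2) := by
      rw [← Real.exp_add, Real.exp_le_exp]
      nlinarith [sq_nonneg (x - 1 / 2)]
    nlinarith [Real.exp_pos (x ^ 2)]
  have := hmono (Set.mem_Ici.mpr le_rfl) (Set.mem_Ici.mpr hv) hv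
  norm_num at this
  linarith

theorem hasSum_abs_coeff_elemSeries_singlePowerSum {a : ℝ} (R : ℝ) (ha : 0 ≤ a) :
    HasSum (fun k => |coeff k (elemSeries (singlePowerSum a))| * R ^ k)
      (2 + (a * R - 1) * Real.exp (a * R)) := by
  have h1 : HasSum (fun k : ℕ => (a * R) ^ k / k.factorial) (Real.exp (a * R)) := by
    exact_mod_cast hasSum_pow_div_factorial (a * R : ℝ)
  have h2 : HasSum (fun k : ℕ => (a * R) ^ k / k.factorial * k) (a * R * Real.exp (a * R)) := by
    exact_mod_cast hasSum_pow_div_factorial_mul (a * R : ℝ)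
  -- `|1 - k| = k - 1` except at `k = 0`, where the discrepancy is `2`.
  have h3 := (hasSum_ite_eq (0 : ℕ) (2 : ℝ)).add (h2.sub h1)
  convert! h3 using 1
  · funext k
    rw [coeff_elemSeries_singlePowerSum, abs_div, abs_mul, abs_pow, abs_neg, abs_of_nonneg ha,
      Nat.abs_cast, mul_pow]
    cases k with
    | zero => norm_num
    | succ k =>
      have : |1 - ((k + 1 : ℕ) : ℝ)| = k := by
        push_cast
        rw [sub_add_cancel_right, abs_neg, Nat.abs_cast]
      rw [this, if_neg k.succ_ne_zero]
      push_cast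
      ring
  · ring

theorem _root_.PowerSeries.summable_abs_coeff_mul {A B : ℝ⟦X⟧} {R : ℝ} (hR : 0 ≤ R)
    (hA : Summable fun s => |coeff s A| * R ^ s) (hB : Summable fun s => |coeff s B| * R ^ s) :
    (Summable fun s => |coeff s (A * B)| * R ^ s) ∧
      ∑' s, |coeff s (A * B)| * R ^ s ≤
        (∑' s, |coeff s A| * R ^ s) * ∑' s, |coeff s B| * R ^ s := by
  have hle : ∀ s, |coeff s (A * B)| * R ^ s ≤
      ∑ x ∈ Finset.HasAntidiagonal.antidiagonal s,
        |coeff x.1 A| * R ^ x.1 * (|coeff x.2 B| * R ^ x.2) := fun s => by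
    rw [coeff_mul]
    refine (mul_le_mul_of_nonneg_right (Finset.abs_sum_le_sum_abs _ _) (pow_nonneg hR s)).trans ?_
    rw [Finset.sum_mul]
    refine Finset.sum_le_sum fun x hx => le_of_eq ?_
    rw [abs_mul, ← Finset.HasAntidiagonal.mem_antidiagonal.mp hx, pow_add]
    ring
  have hA' := hA.norm
  have hB' := hB.norm
  have hs := (summable_norm_sum_mul_antidiagonal_of_summable_norm hA' hB').of_norm
  have hsum : Summable fun s => |coeff s (A * B)| * R ^ s :=
    Summable.of_nonneg_of_le (fun s => by positivity) hle hs
  refine ⟨hsum, (hsum.tsum_le_tsum hle hs).trans (le_of_eq ?_)⟩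
  exact (tsum_mul_tsum_eq_tsum_sum_antidiagonal_of_summable_norm hA' hB').symm

theorem _root_.PowerSeries.hasSum_coeff_mul {A B : ℝ⟦X⟧} {z a b : ℂ}
    (hA : Summable fun s => |coeff s A| * ‖z‖ ^ s) (hB : Summable fun s => |coeff s B| * ‖z‖ ^ s)
    (ha : HasSum (fun s => ((coeff s A : ℝ) : ℂ) * z ^ s) a)
    (hb : HasSum (fun s => ((coeff s B : ℝ) : ℂ) * z ^ s) b) :
    HasSum (fun s => ((coeff s (A * B) : ℝ) : ℂ) * z ^ s) (a * b) := by
  have hA' : Summable fun s => ‖((coeff s A : ℝ) : ℂ) * z ^ s‖ := by simpa using hA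
  have hB' : Summable fun s => ‖((coeff s B : ℝ) : ℂ) * z ^ s‖ := by simpa using hB
  have hs := (summable_norm_sum_mul_antidiagonal_of_summable_norm hA' hB').of_norm.hasSum
  rw [← tsum_mul_tsum_eq_tsum_sum_antidiagonal_of_summable_norm hA' hB', ha.tsum_eq,
    hb.tsum_eq] at hs
  refine hs.congr_fun fun s => ?_
  rw [coeff_mul]
  push_cast
  rw [Finset.sum_mul]
  refine Finset.sum_congr rfl fun x hx => ?_
  rw [← Finset.HasAntidiagonal.mem_antidiagonal.mp hx, pow_add]
  ring

/-- The weighted `ℓ¹` norm of coefficients is submultiplicative, and each factor has norm at most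
`exp((aᵢR)²)`. -/
theorem abs_coeff_prod_elemSeries {a : ℕ → ℝ} (ha : ∀ i, 0 ≤ a i) (n : ℕ) {R : ℝ}
    (hR : 0 ≤ R) :
    (Summable fun s => |coeff s (∏ i ∈ Finset.range n, elemSeries (singlePowerSum (a i)))| * R ^ s) ∧
      ∑' s, |coeff s (∏ i ∈ Finset.range n, elemSeries (singlePowerSum (a i)))| * R ^ s ≤
        Real.exp ((∑ i ∈ Finset.range n, a i ^ 2) * R ^ 2) := by
  induction n with
  | zero =>
    have h : HasSum (fun s => |coeff s (1 : ℝ⟦X⟧)| * R ^ s) 1 := by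
      convert! hasSum_ite_eq (0 : ℕ) (1 : ℝ) using 2 with s
      rw [coeff_one]
      split_ifs with h <;> simp [h]
    simp only [Finset.range_zero, Finset.prod_empty, Finset.sum_empty, zero_mul, Real.exp_zero]
    exact ⟨h.summable, h.tsum_eq.le⟩
  | succ n ih =>
    have h := hasSum_abs_coeff_elemSeries_singlePowerSum R (ha n)
    have hmul := summable_abs_coeff_mul hR ih.1 h.summable
    rw [Finset.prod_range_succ]
    refine ⟨hmul.1, hmul.2.trans ?_⟩
    rw [Finset.sum_range_succ, add_mul, Real.exp_add, h.tsum_eq, ← mul_pow]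
    have hpos : 0 ≤ 2 + (a n * R - 1) * Real.exp (a n * R) :=
      h.nonneg fun s => by positivity
    exact mul_le_mul ih.2 (two_add_sub_one_mul_exp_le (mul_nonneg (ha n) hR)) hpos (Real.exp_pos _).le

theorem hasSum_coeff_prod_elemSeries {a : ℕ → ℝ} (ha : ∀ i, 0 ≤ a i) (n : ℕ) (z : ℂ) :
    HasSum (fun s => ((coeff s (∏ i ∈ Finset.range n, elemSeries (singlePowerSum (a i))) : ℝ) : ℂ) *
      z ^ s)
      (∏ i ∈ Finset.range n, ((1 + a i * z) * Complex.exp (-(a i * z)))) := by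
  induction n with
  | zero =>
    convert! hasSum_ite_eq (0 : ℕ) (1 : ℂ) using 2 with s
    rw [Finset.prod_range_zero, coeff_one]
    split_ifs with h <;> simp [h]
  | succ n ih =>
    rw [Finset.prod_range_succ, Finset.prod_range_succ]
    exact hasSum_coeff_mul (abs_coeff_prod_elemSeries ha n (norm_nonneg z)).1
      (hasSum_abs_coeff_elemSeries_singlePowerSum ‖z‖ (ha n)).summable ih
      (hasSum_coeff_elemSeries_singlePowerSum (a n) z)

theorem abs_coeff_prod_elemSeries_le {a : ℕ → ℝ} (ha : ∀ i, 0 ≤ a i) (n : ℕ) {R : ℝ}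
    (hR : 0 ≤ R) (s : ℕ) :
    |coeff s (∏ i ∈ Finset.range n, elemSeries (singlePowerSum (a i)))| * R ^ s ≤
      Real.exp ((∑ i ∈ Finset.range n, a i ^ 2) * R ^ 2) := by
  obtain ⟨h1, h2⟩ := abs_coeff_prod_elemSeries ha n hR
  exact (h1.le_tsum s fun j _ => by positivity).trans h2

end SymFun

/-! ### Charlier polynomials and differences of the Poisson law. -/

/-- The Charlier polynomials: `charlier lam s k * Poisson(lam){k}` is the `s`-th backward
difference (with sign) of the Poisson distribution of parameter `lam`. -/
noncomputable def charlier (lam : ℝ) : ℕ → ℕ → ℝ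
  | 0, _ => 1
  -- At `k = 0` the truncated `k - 1` is harmless, since its coefficient `k / lam` vanishes.
  | s + 1, k => k / lam * charlier lam s (k - 1) - charlier lam s k

/-- The weight `e^{-lam} lamᵏ / k!`. -/
noncomputable def poissonWeight (lam : ℝ) (k : ℕ) : ℝ := Real.exp (-lam) * lam ^ k / k.factorial

/-- The weights of the convolution of the Poisson distribution with `(δ₁ - δ₀)^{*s}`. -/
noncomputable def poissonDiff (lam : ℝ) (s k : ℕ) : ℝ := poissonWeight lam k * charlier lam s k

section Poisson

variable {lam : ℝ}

theorem hasSum_succ_of_zero {E : Type*} [AddCommGroup E] [TopologicalSpace E]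
    [IsTopologicalAddGroup E] {f : ℕ → E} {S : E} (h0 : f 0 = 0)
    (h : HasSum (fun k => f (k + 1)) S) : HasSum f S := by
  rw [hasSum_nat_add_iff 1] at h
  simpa [h0] using h

theorem poissonWeight_nonneg (hl : 0 < lam) (k : ℕ) : 0 ≤ poissonWeight lam k := by
  rw [poissonWeight]
  positivity

theorem poissonWeight_succ_mul (hl : 0 < lam) (k : ℕ) :
    poissonWeight lam (k + 1) * ((k + 1 : ℕ) / lam) = poissonWeight lam k := by
  rw [poissonWeight, poissonWeight, Nat.factorial_succ]
  push_cast
  have : (k.factorial : ℝ) ≠ 0 := by positivity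
  have : ((k : ℝ) + 1) ≠ 0 := by positivity
  field_simp
  ring

/-- The lowering relation: a forward difference in `k` drops the degree by one. It drives the
computation of the `L²` norms. -/
theorem charlier_succ_sub (hl : 0 < lam) (s k : ℕ) :
    charlier lam (s + 1) (k + 1) - charlier lam (s + 1) k = (s + 1) / lam * charlier lam s k := by
  induction s generalizing k with
  | zero =>
    simp [charlier]
    ring
  | succ s ih =>
    rw [charlier, charlier.eq_2 lam k (s + 1), Nat.add_sub_cancel]
    cases k with
    | zero =>
      have := ih 0
      simp only [charlier] at this ⊢
      simp at this ⊢
      field_simp at this ⊢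
      linear_combination -this
    | succ k =>
      have h1 := ih (k + 1)
      have h2 := ih k
      have h3 := charlier.eq_2 lam (k + 1) s
      rw [Nat.add_sub_cancel] at h3 ⊢
      push_cast at h3 ⊢
      have e1 : charlier lam (s + 1) (k + 1 + 1) =
          charlier lam (s + 1) (k + 1) + (s + 1) / lam * charlier lam s (k + 1) := by
        linear_combination h1
      have e2 : charlier lam (s + 1) k =
          charlier lam (s + 1) (k + 1) - (s + 1) / lam * charlier lam s k := by
        linear_combination -h2
      rw [e1, e2]
      linear_combination -((s : ℝ) + 1) / lam * h3

/-- A crude bound, needed only for summability against the Poisson weights. -/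
theorem exists_abs_charlier_le (hl : 0 < lam) (s : ℕ) :
    ∃ A B : ℝ, 0 ≤ A ∧ 1 ≤ B ∧ ∀ k, |charlier lam s k| ≤ A * B ^ k := by
  induction s with
  | zero => exact ⟨1, 1, by norm_num, le_rfl, fun k => by simp [charlier]⟩
  | succ s ih =>
    obtain ⟨A, B, hA, hB, h⟩ := ih
    refine ⟨(1 / lam + 1) * A, 2 * B, by positivity, by linarith, fun k => ?_⟩
    have hB0 : 0 ≤ B := by linarith
    have hk : (k : ℝ) ≤ 2 ^ k := by exact_mod_cast Nat.lt_two_pow_self.le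
    have h1k : (1 : ℝ) ≤ 2 ^ k := one_le_pow₀ (by norm_num)
    have h1 : |charlier lam s (k - 1)| ≤ A * B ^ k :=
      (h _).trans (mul_le_mul_of_nonneg_left (pow_le_pow_right₀ hB (Nat.sub_le k 1)) hA)
    rw [charlier]
    refine (abs_sub _ _).trans ?_
    rw [abs_mul, abs_of_nonneg (by positivity : (0 : ℝ) ≤ k / lam), mul_pow]
    calc (k : ℝ) / lam * |charlier lam s (k - 1)| + |charlier lam s k|
        ≤ 2 ^ k / lam * (A * B ^ k) + 2 ^ k * (A * B ^ k) := by
          gcongr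
          exact (h k).trans (le_mul_of_one_le_left (by positivity) h1k)
      _ = (1 / lam + 1) * A * (2 ^ k * B ^ k) := by ring

theorem summable_poissonWeight_mul_pow (B : ℝ) :
    Summable fun k => poissonWeight lam k * B ^ k := by
  refine ((Real.summable_pow_div_factorial (lam * B)).mul_left (Real.exp (-lam))).congr fun k => ?_
  rw [poissonWeight, mul_pow]
  ring

theorem summable_poissonWeight_mul_charlier_mul (hl : 0 < lam) (s t : ℕ) :
    Summable fun k => poissonWeight lam k * (charlier lam s k * charlier lam t k) := by
  obtain ⟨A, B, hA, hB, h⟩ := exists_abs_charlier_le hl s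
  obtain ⟨A', B', hA', hB', h'⟩ := exists_abs_charlier_le hl t
  refine Summable.of_norm_bounded
    ((summable_poissonWeight_mul_pow (lam := lam) (B * B')).mul_left (A * A')) fun k => ?_
  rw [Real.norm_eq_abs, abs_mul, abs_mul, abs_of_nonneg (poissonWeight_nonneg hl k)]
  calc poissonWeight lam k * (|charlier lam s k| * |charlier lam t k|)
      ≤ poissonWeight lam k * ((A * B ^ k) * (A' * B' ^ k)) := by
        gcongr
        · exact poissonWeight_nonneg hl k
        · exact h k
        · exact h' k
    _ = _ := by rw [mul_pow]; ring

theorem hasSum_poissonWeight : HasSum (poissonWeight lam) 1 := by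
  have h := (NormedSpace.expSeries_div_hasSum_exp lam).mul_left (Real.exp (-lam))
  rw [← Real.exp_eq_exp_ℝ, ← Real.exp_add, neg_add_cancel, Real.exp_zero] at h
  exact h.congr_fun fun k => by rw [poissonWeight, mul_div_assoc]

/-- Expand one factor of the square by the recursion, shift `k` and apply the lowering relation. The
cross term `T` appears twice and cancels, so orthogonality is never needed. -/
theorem hasSum_poissonWeight_mul_charlier_sq (hl : 0 < lam) (s : ℕ) :
    HasSum (fun k => poissonWeight lam k * charlier lam s k ^ 2) (s.factorial / lam ^ s) := by
  induction s with
  | zero => simpa [charlier] using hasSum_poissonWeight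
  | succ s ih =>
    have hT := (summable_poissonWeight_mul_charlier_mul hl (s + 1) s).hasSum
    set T := ∑' k, poissonWeight lam k * (charlier lam (s + 1) k * charlier lam s k)
    have h1 : HasSum (fun k => poissonWeight lam k * (k / lam) *
        (charlier lam (s + 1) k * charlier lam s (k - 1)))
        (T + (s + 1) / lam * (s.factorial / lam ^ s)) := by
      refine hasSum_succ_of_zero (by simp) ?_
      refine (hT.add (ih.mul_left ((s + 1) / lam))).congr_fun fun k => ?_
      rw [poissonWeight_succ_mul hl, Nat.add_sub_cancel]
      linear_combination poissonWeight lam k * charlier lam s k * charlier_succ_sub hl s k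
    have h2 := h1.sub hT
    rw [add_sub_cancel_left] at h2
    convert! h2 using 1
    · funext k
      rw [sq]
      nth_rw 2 [charlier]
      ring
    · rw [Nat.factorial_succ, pow_succ]
      push_cast
      field_simp

theorem summable_abs_poissonDiff (hl : 0 < lam) (s : ℕ) :
    Summable fun k => |poissonDiff lam s k| := by
  have h := summable_poissonWeight_mul_charlier_mul hl s 0
  simp only [charlier, mul_one] at h
  exact h.abs

/-- Cauchy-Schwarz for the Poisson probability, in the pointwise form `|C| ≤ t/2 + C²/(2t)` with `t`
the `L²` norm. -/
theorem tsum_abs_poissonDiff_le_sqrt (hl : 0 < lam) (s : ℕ) :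
    ∑' k, |poissonDiff lam s k| ≤ √(s.factorial / lam ^ s) := by
  set t := √(s.factorial / lam ^ s) with ht
  have hpos : (0 : ℝ) < s.factorial / lam ^ s := by positivity
  have ht0 : 0 < t := Real.sqrt_pos.mpr hpos
  have ht2 : t ^ 2 = s.factorial / lam ^ s := Real.sq_sqrt hpos.le
  have h := (hasSum_poissonWeight (lam := lam).mul_left (t / 2)).add
    ((hasSum_poissonWeight_mul_charlier_sq hl s).mul_left (1 / (2 * t)))
  refine ((summable_abs_poissonDiff hl s).tsum_le_tsum (fun k => ?_) h.summable).trans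
    (le_of_eq ?_)
  · rw [poissonDiff, abs_mul, abs_of_nonneg (poissonWeight_nonneg hl k)]
    have key : |charlier lam s k| ≤ t / 2 + 1 / (2 * t) * charlier lam s k ^ 2 := by
      rw [← sub_nonneg]
      have : t / 2 + 1 / (2 * t) * charlier lam s k ^ 2 - |charlier lam s k| =
          (t - |charlier lam s k|) ^ 2 / (2 * t) := by
        rw [sub_sq, sq_abs]
        field_simp
        ring
      rw [this]
      positivity
    nlinarith [mul_le_mul_of_nonneg_left key (poissonWeight_nonneg hl k)]
  · rw [h.tsum_eq, ← ht2]
    field_simp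
    norm_num

theorem poissonDiff_zero_right_succ (s : ℕ) :
    poissonDiff lam (s + 1) 0 = - poissonDiff lam s 0 := by
  simp [poissonDiff, charlier]

theorem poissonDiff_succ_succ (hl : 0 < lam) (s k : ℕ) :
    poissonDiff lam (s + 1) (k + 1) = poissonDiff lam s k - poissonDiff lam s (k + 1) := by
  rw [poissonDiff, charlier, Nat.add_sub_cancel, mul_sub, ← mul_assoc, poissonWeight_succ_mul hl,
    poissonDiff, poissonDiff]

/-- Each further difference at most doubles the `ℓ¹` norm. -/
theorem tsum_abs_poissonDiff_le_two_pow (hl : 0 < lam) (s : ℕ) :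
    ∑' k, |poissonDiff lam s k| ≤ 2 ^ s := by
  induction s with
  | zero =>
    have h : (fun k => |poissonDiff lam 0 k|) = poissonWeight lam := by
      funext k
      rw [poissonDiff, charlier, mul_one, abs_of_nonneg (poissonWeight_nonneg hl k)]
    rw [h, hasSum_poissonWeight.tsum_eq, pow_zero]
  | succ s ih =>
    have hs := summable_abs_poissonDiff hl s
    have hs' := summable_abs_poissonDiff hl (s + 1)
    have hsh := (summable_nat_add_iff 1).mpr hs
    rw [hs'.tsum_eq_zero_add, poissonDiff_zero_right_succ, abs_neg]
    have h1 : ∑' k, |poissonDiff lam (s + 1) (k + 1)| ≤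
        ∑' k, |poissonDiff lam s k| + ∑' k, |poissonDiff lam s (k + 1)| := by
      rw [← hs.tsum_add hsh]
      refine ((summable_nat_add_iff 1).mpr hs').tsum_le_tsum (fun k => ?_) (hs.add hsh)
      rw [poissonDiff_succ_succ hl]
      exact abs_sub _ _
    have h2 := hs.tsum_eq_zero_add
    rw [pow_succ]
    linarith

/-- The sum of the differences of orders `s + 1` and `s` is the shift of the latter, and shifting
multiplies the generating function by `w`. -/
theorem hasSum_poissonDiff_mul_pow (hl : 0 < lam) (s : ℕ) (w : ℂ) :
    HasSum (fun k => (poissonDiff lam s k : ℂ) * w ^ k)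
      (Complex.exp (lam * (w - 1)) * (w - 1) ^ s) := by
  induction s with
  | zero =>
    have h := (NormedSpace.expSeries_div_hasSum_exp (lam * w : ℂ)).mul_left (Complex.exp (-lam))
    rw [← Complex.exp_eq_exp_ℂ, ← Complex.exp_add] at h
    rw [pow_zero, mul_one, show (lam : ℂ) * (w - 1) = -lam + lam * w by ring]
    refine h.congr_fun fun k => ?_
    rw [poissonDiff, charlier, poissonWeight]
    push_cast
    ring
  | succ s ih =>
    have h : HasSum (fun k => ((poissonDiff lam (s + 1) k : ℂ) + poissonDiff lam s k) * w ^ k)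
        (w * (Complex.exp (lam * (w - 1)) * (w - 1) ^ s)) := by
      refine hasSum_succ_of_zero (by simp [poissonDiff_zero_right_succ]) ?_
      refine (ih.mul_left w).congr_fun fun k => ?_
      rw [poissonDiff_succ_succ hl]
      push_cast
      ring
    convert! h.sub ih using 1
    · funext k
      ring
    · ring

end Poisson

/-! ### Fourier uniqueness and the law of the Bernoulli sum. -/

theorem eq_zero_of_hasSum_fourier_eq_zero {a : ℕ → ℂ} (ha : Summable fun k => ‖a k‖)
    (h : ∀ ξ : ℝ, HasSum (fun k : ℕ => a k * Complex.exp (Complex.I * k * ξ)) 0) : a = 0 := by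
  funext m
  have hexp : ∀ x : ℝ, ‖Complex.exp (Complex.I * x)‖ = 1 := fun x => by
    rw [mul_comm, Complex.norm_exp_ofReal_mul_I]
  -- Multiply by `e^{-imξ}` and integrate termwise over a period: only `k = m` survives.
  have hI : HasSum (fun k : ℕ => ∫ ξ in (0 : ℝ)..2 * Real.pi,
      a k * Complex.exp (Complex.I * ((k : ℂ) - m) * ξ)) (∫ ξ in (0 : ℝ)..2 * Real.pi, (0 : ℂ)) := by
    refine intervalIntegral.hasSum_integral_of_dominated_convergence (fun k _ => ‖a k‖)
      (fun k => by fun_prop) (fun k => ?_) (by simp [ha]) (by simp) ?_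
    · refine Filter.Eventually.of_forall fun ξ _ => le_of_eq ?_
      have := hexp (((k : ℝ) - m) * ξ)
      push_cast at this
      rw [norm_mul, mul_assoc, this, mul_one]
    · refine Filter.Eventually.of_forall fun ξ _ => ?_
      have h1 := (h ξ).mul_right (Complex.exp (-(Complex.I * m * ξ)))
      rw [zero_mul] at h1
      convert! h1 using 2 with k
      rw [mul_assoc (a k), ← Complex.exp_add]
      congr 2
      ring
  have hz : ∀ k : ℕ, k ≠ m → ∫ ξ in (0 : ℝ)..2 * Real.pi,
      a k * Complex.exp (Complex.I * ((k : ℂ) - m) * ξ) = 0 := fun k hk => by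
    have hc : Complex.I * ((k : ℂ) - m) ≠ 0 :=
      mul_ne_zero Complex.I_ne_zero (sub_ne_zero.mpr (by exact_mod_cast hk))
    rw [intervalIntegral.integral_const_mul, integral_exp_mul_complex hc]
    have h1 : Complex.exp (Complex.I * ((k : ℂ) - m) * (2 * Real.pi : ℝ)) = 1 := by
      rw [Complex.exp_eq_one_iff]
      exact ⟨(k : ℤ) - m, by push_cast; ring⟩
    rw [h1]
    simp
  have h2 := hI.unique (hasSum_single m hz)
  simpa [Real.pi_ne_zero] using h2.symm

theorem MeasureTheory.SignedMeasure.summable_abs_singleton (ν : SignedMeasure ℕ) :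
    Summable fun k : ℕ => |ν {k}| := by
  simpa [Measure.real] using summable_dTV 0 ν

theorem MeasureTheory.SignedMeasure.ext_singleton {ν ν' : SignedMeasure ℕ}
    (h : ∀ k : ℕ, ν {k} = ν' {k}) : ν = ν' := by
  have key : ∀ (ρ : SignedMeasure ℕ) (s : Set ℕ), HasSum (fun k : s => ρ {(k : ℕ)}) (ρ s) :=
    fun ρ s => by
      have := VectorMeasure.hasSum_of_disjoint_iUnion (v := ρ)
        (f := fun k : s => ({(k : ℕ)} : Set ℕ)) (fun _ => MeasurableSet.singleton _)
        (fun i j hij => by simpa [Subtype.ext_iff] using hij)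
      rwa [Set.iUnion_of_singleton_coe] at this
  refine VectorMeasure.ext fun s _ => (key ν s).unique ?_
  simpa only [h] using key ν' s

/-- The signed measure on `ℕ` with given summable weights. -/
noncomputable def signedMeasureOfWeights (m : ℕ → ℝ) : SignedMeasure ℕ :=
  Measure.count.withDensityᵥ m

theorem signedMeasureOfWeights_singleton {m : ℕ → ℝ} (hm : Summable fun k => |m k|) (k : ℕ) :
    signedMeasureOfWeights m {k} = m k := by
  have hint : Integrable m Measure.count := integrable_count_iff.mpr hm
  rw [signedMeasureOfWeights, withDensityᵥ_apply hint (MeasurableSet.singleton k),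
    integral_singleton]
  simp [Measure.real]

theorem signedMeasure_eq_of_fourier {m : ℕ → ℝ} (hm : Summable fun k => |m k|)
    {ν : SignedMeasure ℕ} {F : ℝ → ℂ}
    (h : ∀ ξ : ℝ, HasSum (fun k : ℕ => (m k : ℂ) * Complex.exp (Complex.I * k * ξ)) (F ξ))
    (h' : ∀ ξ : ℝ, HasSum (fun k : ℕ => (ν {k} : ℂ) * Complex.exp (Complex.I * k * ξ)) (F ξ))
    (k : ℕ) : ν {k} = m k := by
  have h0 := eq_zero_of_hasSum_fourier_eq_zero (a := fun k => ((ν {k} - m k : ℝ) : ℂ)) ?_ ?_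
  · have := congrFun h0 k
    simpa [sub_eq_zero] using this
  · simp only [Complex.norm_real, Real.norm_eq_abs]
    exact (ν.summable_abs_singleton.add hm).of_nonneg_of_le (fun k => abs_nonneg _)
      fun k => abs_sub (ν {k}) (m k)
  · intro ξ
    have := (h' ξ).sub (h ξ)
    rw [sub_self] at this
    convert! this using 2 with k
    push_cast
    ring

theorem hasSum_real_singleton_map {Ω : Type*} [MeasurableSpace Ω] {P : Measure Ω}
    [IsProbabilityMeasure P] {n : ℕ} {p : ℕ → ℝ} (hp : ∀ i, 0 < p i ∧ p i < 1)
    {Y : Fin n → Ω → ℕ}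
    (hY : ∀ i, HasLaw (Y i) (bernoulliMeasure 1 0 ⟨p i, (hp i).1.le, (hp i).2.le⟩) P)
    (hind : iIndepFun Y P) (ξ : ℝ) :
    HasSum (fun k : ℕ => ((P.map fun ω => ∑ i, Y i ω).real {k} : ℂ) *
        Complex.exp (Complex.I * k * ξ))
      (∏ i ∈ Finset.range n, (1 + p i * (Complex.exp (Complex.I * ξ) - 1))) := by
  have hYm : ∀ i, AEMeasurable (Y i) P := fun i => (hY i).aemeasurable
  have hX : AEMeasurable (fun ω => ∑ i, Y i ω) P := Finset.aemeasurable_fun_sum _ fun i _ => hYm i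
  have hprob : IsProbabilityMeasure (P.map fun ω => ∑ i, Y i ω) :=
    Measure.isProbabilityMeasure_map hX
  set w := Complex.exp (Complex.I * ξ) with hw
  have hnorm : ‖w‖ = 1 := by rw [hw, mul_comm, Complex.norm_exp_ofReal_mul_I]
  have hint : Integrable (fun k : ℕ => w ^ k) (P.map fun ω => ∑ i, Y i ω) :=
    Integrable.of_bound (by fun_prop) 1 (Filter.Eventually.of_forall fun k => by simp [hnorm])
  have hval : ∫ k, w ^ k ∂(P.map fun ω => ∑ i, Y i ω) =
      ∏ i ∈ Finset.range n, (1 + p i * (w - 1)) := by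
    rw [integral_map hX (by fun_prop)]
    simp only [← Finset.prod_pow_eq_pow_sum]
    rw [hind.integral_fun_prod_comp (f := fun _ (k : ℕ) => w ^ k) hYm (fun i => by fun_prop),
      Finset.prod_range]
    refine Finset.prod_congr rfl fun i _ => ?_
    have h1 := (hY i).integral_comp (f := fun k : ℕ => w ^ k) (by fun_prop)
    rw [Function.comp_def] at h1
    rw [h1, integral_bernoulliMeasure]
    simp
    ring
  have hsum := hasSum_integral_iUnion (f := fun k : ℕ => w ^ k)
    (μ := P.map fun ω => ∑ i, Y i ω) (s := fun k : ℕ => ({k} : Set ℕ))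
    (fun _ => MeasurableSet.singleton _) (fun i j hij => by simpa using hij)
    hint.integrableOn
  rw [Set.iUnion_of_singleton, Measure.restrict_univ, hval] at hsum
  convert! hsum using 2 with k
  rw [integral_singleton, Complex.real_smul, hw, ← Complex.exp_nat_mul]
  congr 2
  ring

/-! ### Infinite combinations of Poisson differences. -/

/-- The weights of the signed measure with generating function
`e^{lam (w - 1)} ∑ₛ cₛ (w - 1)ˢ`. -/
noncomputable def poissonMixture (lam : ℝ) (c : ℕ → ℝ) (k : ℕ) : ℝ :=
  ∑' s, c s * poissonDiff lam s k

section Mixture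

variable {lam : ℝ} {c : ℕ → ℝ}

/-- The weight `2ˢ` is the `ℓ¹` bound on the `s`-th difference; absolute summability in `(s, k)`
justifies all later exchanges of sums. -/
theorem summable_abs_mul_poissonDiff (hl : 0 < lam) (hc : Summable fun s => |c s| * 2 ^ s) :
    Summable fun x : ℕ × ℕ => |c x.1 * poissonDiff lam x.1 x.2| := by
  rw [summable_prod_of_nonneg fun x => abs_nonneg _]
  simp only [abs_mul]
  refine ⟨fun s => (summable_abs_poissonDiff hl s).mul_left _, ?_⟩
  simp only [tsum_mul_left]
  exact hc.of_nonneg_of_le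
    (fun _ => mul_nonneg (abs_nonneg _) (tsum_nonneg fun _ => abs_nonneg _))
    fun s => mul_le_mul_of_nonneg_left (tsum_abs_poissonDiff_le_two_pow hl s) (abs_nonneg _)

theorem summable_abs_mul_tsum_abs_poissonDiff (hl : 0 < lam)
    (hc : Summable fun s => |c s| * 2 ^ s) :
    Summable fun s => |c s| * ∑' k, |poissonDiff lam s k| :=
  hc.of_nonneg_of_le (fun _ => mul_nonneg (abs_nonneg _) (tsum_nonneg fun _ => abs_nonneg _))
    fun s => mul_le_mul_of_nonneg_left (tsum_abs_poissonDiff_le_two_pow hl s) (abs_nonneg _)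

theorem summable_mul_poissonDiff (hl : 0 < lam) (hc : Summable fun s => |c s| * 2 ^ s) (k : ℕ) :
    Summable fun s => |c s * poissonDiff lam s k| :=
  (summable_abs_mul_poissonDiff hl hc).prod_symm.prod_factor k

theorem abs_poissonMixture_le (hl : 0 < lam) (hc : Summable fun s => |c s| * 2 ^ s) (k : ℕ) :
    |poissonMixture lam c k| ≤ ∑' s, |c s * poissonDiff lam s k| :=
  norm_tsum_le_tsum_norm (f := fun s => c s * poissonDiff lam s k)
    (summable_mul_poissonDiff hl hc k)

theorem summable_abs_poissonMixture (hl : 0 < lam) (hc : Summable fun s => |c s| * 2 ^ s) :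
    Summable fun k => |poissonMixture lam c k| :=
  (summable_abs_mul_poissonDiff hl hc).prod_symm.prod.of_nonneg_of_le (fun _ => abs_nonneg _)
    (abs_poissonMixture_le hl hc)

theorem tsum_abs_poissonMixture_le (hl : 0 < lam) (hc : Summable fun s => |c s| * 2 ^ s) :
    ∑' k, |poissonMixture lam c k| ≤ ∑' s, |c s| * ∑' k, |poissonDiff lam s k| := by
  have h := summable_abs_mul_poissonDiff hl hc
  refine ((summable_abs_poissonMixture hl hc).tsum_le_tsum (abs_poissonMixture_le hl hc)
    h.prod_symm.prod).trans (le_of_eq ?_)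
  rw [h.tsum_comm (f := fun s k => |c s * poissonDiff lam s k|)]
  simp only [abs_mul, tsum_mul_left]

theorem hasSum_poissonMixture_mul_pow (hl : 0 < lam) (hc : Summable fun s => |c s| * 2 ^ s)
    {w V : ℂ} (hw : ‖w‖ = 1) (hV : HasSum (fun s => (c s : ℂ) * (w - 1) ^ s) V) :
    HasSum (fun k => (poissonMixture lam c k : ℂ) * w ^ k)
      (Complex.exp (lam * (w - 1)) * V) := by
  have hG : Summable fun x : ℕ × ℕ => (c x.1 : ℂ) * ((poissonDiff lam x.1 x.2 : ℂ) * w ^ x.2) := by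
    refine Summable.of_norm ?_
    simpa [hw, abs_mul] using summable_abs_mul_poissonDiff hl hc
  have h1 := hG.hasSum.prod_fiberwise fun s => (hasSum_poissonDiff_mul_pow hl s w).mul_left (c s : ℂ)
  have h2 : HasSum (fun s => (c s : ℂ) * (Complex.exp (lam * (w - 1)) * (w - 1) ^ s))
      (Complex.exp (lam * (w - 1)) * V) := by
    convert! hV.mul_left (Complex.exp (lam * (w - 1))) using 2 with s
    ring
  have h3 := hG.hasSum
  rw [← (Equiv.prodComm ℕ ℕ).hasSum_iff] at h3
  rw [h2.unique h1]
  refine h3.prod_fiberwise fun k => ?_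
  have h4 := (summable_mul_poissonDiff hl hc k).of_abs.hasSum
  have h5 := (Complex.hasSum_ofReal.mpr h4).mul_right (w ^ k)
  convert! h5 using 2 with s
  simp
  ring

theorem poissonMixture_sub {c' : ℕ → ℝ} (hl : 0 < lam) (hc : Summable fun s => |c s| * 2 ^ s)
    (hc' : Summable fun s => |c' s| * 2 ^ s) (k : ℕ) :
    poissonMixture lam c k - poissonMixture lam c' k = poissonMixture lam (c - c') k := by
  rw [poissonMixture, poissonMixture, poissonMixture,
    ← (summable_mul_poissonDiff hl hc k).of_abs.tsum_sub (summable_mul_poissonDiff hl hc' k).of_abs]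
  simp only [Pi.sub_apply, sub_mul]

end Mixture

/-! ### Existence and uniqueness of the scheme. -/

/-- The coefficients of `1 + ∑_{s=2}^r bₛ zˢ`. -/
noncomputable def schemeCoeff (b : ℕ → ℝ) (r s : ℕ) : ℝ :=
  if s = 0 then 1 else if s ∈ Finset.Icc 2 r then b s else 0

theorem schemeCoeff_eq_zero (b : ℕ → ℝ) {r s : ℕ} (hs : s ∉ insert 0 (Finset.Icc 2 r)) :
    schemeCoeff b r s = 0 := by
  rw [Finset.mem_insert, not_or] at hs
  rw [schemeCoeff, if_neg hs.1, if_neg hs.2]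

theorem hasSum_schemeCoeff_mul_pow (b : ℕ → ℝ) (r : ℕ) (z : ℂ) :
    HasSum (fun s => (schemeCoeff b r s : ℂ) * z ^ s)
      (1 + ∑ s ∈ Finset.Icc 2 r, (b s : ℂ) * z ^ s) := by
  have h : HasSum (fun s => (schemeCoeff b r s : ℂ) * z ^ s)
      (∑ s ∈ insert 0 (Finset.Icc 2 r), (schemeCoeff b r s : ℂ) * z ^ s) :=
    hasSum_sum_of_ne_finset_zero fun s hs => by simp [schemeCoeff_eq_zero b hs]
  rw [Finset.sum_insert (by simp)] at h
  convert! h using 2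
  · simp [schemeCoeff]
  · refine Finset.sum_congr rfl fun s hs => ?_
    have h0 : s ≠ 0 := by
      rw [Finset.mem_Icc] at hs
      omega
    rw [schemeCoeff, if_neg h0, if_pos hs]

theorem summable_abs_schemeCoeff (b : ℕ → ℝ) (r : ℕ) :
    Summable fun s => |schemeCoeff b r s| * 2 ^ s :=
  summable_of_ne_finset_zero (s := insert 0 (Finset.Icc 2 r))
    fun s hs => by simp [schemeCoeff_eq_zero b hs]

theorem norm_exp_I_mul_ofReal (ξ : ℝ) : ‖Complex.exp (Complex.I * ξ)‖ = 1 := by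
  rw [mul_comm, Complex.norm_exp_ofReal_mul_I]

theorem exp_I_mul_natCast_mul (k : ℕ) (ξ : ℝ) :
    Complex.exp (Complex.I * k * ξ) = Complex.exp (Complex.I * ξ) ^ k := by
  rw [← Complex.exp_nat_mul]
  congr 1
  ring

/-- Replaces the Fourier condition by explicit weights, so that comparing the scheme with the law
becomes comparing coefficients. -/
theorem isPoissonScheme_iff {lam : ℝ} (hl : 0 < lam) (b : ℕ → ℝ) (r : ℕ) (ν : SignedMeasure ℕ) :
    IsPoissonScheme lam b r ν ↔ ∀ k : ℕ, ν {k} = poissonMixture lam (schemeCoeff b r) k := by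
  have hs := summable_abs_schemeCoeff b r
  have hF : ∀ ξ : ℝ, HasSum (fun k : ℕ => (poissonMixture lam (schemeCoeff b r) k : ℂ) *
      Complex.exp (Complex.I * k * ξ)) (Complex.exp (lam * (Complex.exp (Complex.I * ξ) - 1)) *
      (1 + ∑ s ∈ Finset.Icc 2 r, (b s : ℂ) * (Complex.exp (Complex.I * ξ) - 1) ^ s)) := fun ξ => by
    simp only [exp_I_mul_natCast_mul]
    exact hasSum_poissonMixture_mul_pow hl hs (norm_exp_I_mul_ofReal ξ)
      (hasSum_schemeCoeff_mul_pow b r _)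
  refine ⟨fun h => signedMeasure_eq_of_fourier (summable_abs_poissonMixture hl hs) hF h,
    fun h ξ => ?_⟩
  simpa only [h] using hF ξ

theorem existsUnique_isPoissonScheme {lam : ℝ} (hl : 0 < lam) (b : ℕ → ℝ) (r : ℕ) :
    ∃! ν : SignedMeasure ℕ, IsPoissonScheme lam b r ν := by
  simp only [isPoissonScheme_iff hl]
  refine ⟨signedMeasureOfWeights (poissonMixture lam (schemeCoeff b r)),
    signedMeasureOfWeights_singleton
      (summable_abs_poissonMixture hl (summable_abs_schemeCoeff b r)), fun ν hν => ?_⟩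
  refine SignedMeasure.ext_singleton fun k => ?_
  rw [hν, signedMeasureOfWeights_singleton
    (summable_abs_poissonMixture hl (summable_abs_schemeCoeff b r))]

/-! ### Comparison of the coefficients and the final estimate. -/

namespace SymFun

open PowerSeries

/-- The coefficients `𝔢ₛ({p₀, …, pₙ₋₁}')`. -/
noncomputable def finiteCoeff (p : ℕ → ℝ) (n s : ℕ) : ℝ :=
  coeff s (∏ i ∈ Finset.range n, elemSeries (singlePowerSum (p i)))

theorem summable_abs_finiteCoeff {p : ℕ → ℝ} (hp : ∀ i, 0 ≤ p i) (n : ℕ) :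
    Summable fun s => |finiteCoeff p n s| * 2 ^ s :=
  (abs_coeff_prod_elemSeries hp n zero_le_two).1

/-- Multiplying and dividing each factor `1 + pᵢz` by `e^{pᵢz}` extracts the Poisson factor `e^{lam
z}`. -/
theorem real_map_sum_singleton {Ω : Type*} [MeasurableSpace Ω] {P : Measure Ω}
    [IsProbabilityMeasure P] {n : ℕ} {p : ℕ → ℝ} (hp : ∀ i, 0 < p i ∧ p i < 1)
    (hl : 0 < ∑ i ∈ Finset.range n, p i) {Y : Fin n → Ω → ℕ}
    (hY : ∀ i, HasLaw (Y i) (bernoulliMeasure 1 0 ⟨p i, (hp i).1.le, (hp i).2.le⟩) P)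
    (hind : iIndepFun Y P) (k : ℕ) :
    (P.map fun ω => ∑ i, Y i ω).real {k} =
      poissonMixture (∑ i ∈ Finset.range n, p i) (finiteCoeff p n) k := by
  have hp0 : ∀ i, 0 ≤ p i := fun i => (hp i).1.le
  have hs := summable_abs_finiteCoeff hp0 n
  have hprob : IsProbabilityMeasure (P.map fun ω => ∑ i, Y i ω) :=
    Measure.isProbabilityMeasure_map
      (Finset.aemeasurable_fun_sum _ fun i _ => (hY i).aemeasurable)
  have h := signedMeasure_eq_of_fourier (summable_abs_poissonMixture hl hs)
    (ν := (P.map fun ω => ∑ i, Y i ω).toSignedMeasure)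
    (F := fun ξ => ∏ i ∈ Finset.range n, (1 + p i * (Complex.exp (Complex.I * ξ) - 1)))
    (fun ξ => ?_) (fun ξ => ?_) k
  · rwa [Measure.toSignedMeasure_apply_measurable (MeasurableSet.singleton k)] at h
  · have h1 := hasSum_poissonMixture_mul_pow hl hs (norm_exp_I_mul_ofReal ξ)
      (hasSum_coeff_prod_elemSeries hp0 n (Complex.exp (Complex.I * ξ) - 1))
    simp only [exp_I_mul_natCast_mul]
    convert! h1 using 1
    rw [Finset.prod_mul_distrib, ← Complex.exp_sum, Finset.sum_neg_distrib, ← Finset.sum_mul,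
      mul_left_comm, ← Complex.exp_add]
    push_cast
    rw [add_neg_cancel, Complex.exp_zero, mul_one]
  · simp only [Measure.toSignedMeasure_apply_measurable (MeasurableSet.singleton _)]
    exact hasSum_real_singleton_map hp hY hind ξ

/-- The contribution of order `s` to the Poisson expansion of the law decays geometrically. -/
theorem abs_finiteCoeff_mul_le {p : ℕ → ℝ} (hp : ∀ i, 0 ≤ p i) {n s : ℕ} {σ lam : ℝ} (hσ : 0 < σ)
    (hl : 0 < lam) (hsq : ∑ i ∈ Finset.range n, p i ^ 2 ≤ σ ^ 2) (hs : 1 ≤ s) :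
    |finiteCoeff p n s| * ∑' k, |poissonDiff lam s k| ≤
      (4 * √(Real.exp 1) * σ / √lam / 2) ^ s := by
  have hs0 : (0 : ℝ) < s := by exact_mod_cast hs
  -- This radius minimises `R^{-s} exp(σ²R²)`.
  set R := √(s / (2 * σ ^ 2)) with hR
  have hR2 : R ^ 2 = s / (2 * σ ^ 2) := Real.sq_sqrt (by positivity)
  have h1 : |finiteCoeff p n s| * R ^ s ≤ Real.exp (s / 2) := by
    refine (abs_coeff_prod_elemSeries_le hp n (Real.sqrt_nonneg _) s).trans ?_
    rw [Real.exp_le_exp, hR2]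
    calc (∑ i ∈ Finset.range n, p i ^ 2) * ((s : ℝ) / (2 * σ ^ 2)) ≤ σ ^ 2 * (s / (2 * σ ^ 2)) := by
          gcongr
      _ = (s : ℝ) / 2 := by field_simp
  have h2 : finiteCoeff p n s ^ 2 * (s / (2 * σ ^ 2)) ^ s ≤ Real.exp 1 ^ s := by
    have := pow_le_pow_left₀ (by positivity) h1 2
    rw [mul_pow, sq_abs, ← pow_mul, mul_comm s 2, pow_mul, hR2, ← Real.exp_nat_mul] at this
    refine this.trans (le_of_eq ?_)
    rw [← Real.exp_nat_mul]
    congr 1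
    push_cast
    ring
  have h3 : (s.factorial : ℝ) ≤ (s : ℝ) ^ s := by exact_mod_cast Nat.factorial_le_pow s
  refine (mul_le_mul_of_nonneg_left (tsum_abs_poissonDiff_le_sqrt hl s) (abs_nonneg _)).trans ?_
  refine le_of_sq_le_sq ?_ (by positivity)
  rw [mul_pow, sq_abs, Real.sq_sqrt (by positivity), ← pow_mul, mul_comm s 2, pow_mul,
    div_pow (4 * √(Real.exp 1) * σ / √lam) 2 2, div_pow (4 * √(Real.exp 1) * σ) (√lam) 2,
    mul_pow (4 * √(Real.exp 1)) σ 2, mul_pow 4 (√(Real.exp 1)) 2, Real.sq_sqrt (Real.exp_pos _).le, Real.sq_sqrt hl.le]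
  -- After squaring, the `sˢ` bounding `s!` is absorbed by the power of the optimal radius, leaving
  -- the ratio `2eσ²/lam`. This is relaxed to `4eσ²/lam = (η/2)²`.
  calc finiteCoeff p n s ^ 2 * (s.factorial / lam ^ s)
      ≤ finiteCoeff p n s ^ 2 * ((s : ℝ) ^ s / lam ^ s) := by gcongr
    _ = finiteCoeff p n s ^ 2 * (s / (2 * σ ^ 2)) ^ s * (2 * σ ^ 2 / lam) ^ s := by
      rw [mul_assoc, ← mul_pow, ← div_pow]
      congr 2
      field_simp
    _ ≤ Real.exp 1 ^ s * (2 * σ ^ 2 / lam) ^ s := by gcongr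
    _ = (2 * (Real.exp 1 * σ ^ 2 / lam)) ^ s := by
      rw [← mul_pow]
      congr 1
      ring
    _ ≤ (4 ^ 2 * Real.exp 1 * σ ^ 2 / lam / 2 ^ 2) ^ s := by
      refine pow_le_pow_left₀ (by positivity) ?_ s
      have : 0 ≤ Real.exp 1 * σ ^ 2 / lam := by positivity
      have e : 4 ^ 2 * Real.exp 1 * σ ^ 2 / lam / 2 ^ 2 = 4 * (Real.exp 1 * σ ^ 2 / lam) := by ring
      rw [e]
      linarith

theorem abs_finiteCoeff_sub_le {p : ℕ → ℝ} (hp : ∀ i, 0 ≤ p i) (hs : Summable fun i => p i ^ 2)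
    {σ : ℝ} (hσ : 0 ≤ σ) (hsum : ∑' i, p i ^ 2 = σ ^ 2) (n s : ℕ) :
    |finiteCoeff p n (s + 2) - virtualAlphabet p (elem (s + 2))| ≤
      (s + 1) * (∑' i, p (n + i) ^ 2) * σ ^ s := by
  have hs' : Summable fun i => p (n + i) ^ 2 := by
    simpa only [add_comm n] using (summable_nat_add_iff n).mpr hs
  have hτ2 : √(∑' i, p (n + i) ^ 2) ^ 2 = ∑' i, p (n + i) ^ 2 :=
    Real.sq_sqrt (tsum_nonneg fun i => sq_nonneg _)
  have hσ' : √(∑' i, p i ^ 2) = σ := by rw [hsum, Real.sqrt_sq hσ]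
  have hτσ : √(∑' i, p (n + i) ^ 2) ≤ σ := by
    rw [← hσ']
    refine Real.sqrt_le_sqrt ?_
    rw [← hs.sum_add_tsum_nat_add n]
    simp only [add_comm n]
    exact le_add_of_nonneg_left (Finset.sum_nonneg fun i _ => sq_nonneg _)
  rw [virtualAlphabet_elem, virtualPowerSum_eq_add hp hs n, finiteCoeff, ← elemSeries_sum,
    abs_sub_comm, ← hτ2]
  refine abs_coeff_elemSeries_add_sub_le (Real.sqrt_nonneg _) hτσ (fun k => ?_) (fun k => ?_)
    (by simp [virtualPowerSum]) s
  · rw [← hσ']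
    exact abs_sum_singlePowerSum_le hp hs n k
  · exact abs_virtualPowerSum_le (a := fun i => p (n + i)) (fun i => hp _) hs' k

theorem finiteCoeff_zero (p : ℕ → ℝ) (n : ℕ) : finiteCoeff p n 0 = 1 := by
  rw [finiteCoeff, ← elemSeries_sum, coeff_zero_eq_constantCoeff_apply, constantCoeff_elemSeries]

theorem finiteCoeff_one (p : ℕ → ℝ) (n : ℕ) : finiteCoeff p n 1 = 0 := by
  rw [finiteCoeff, ← elemSeries_sum, coeff_one_elemSeries]
  simp [singlePowerSum]

/-- Orders `0` and `1` agree exactly for `r ≥ 1`. Orders `2` to `r` see only the tail of the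
sequence, with the `2ˢ` norm bound; beyond `r` the scheme contributes nothing and the geometric
decay applies. -/
theorem abs_finiteCoeff_sub_schemeCoeff_mul_le {p : ℕ → ℝ} (hp : ∀ i, 0 ≤ p i)
    (hs : Summable fun i => p i ^ 2) {σ lam : ℝ} (hσ : 0 < σ) (hl : 0 < lam)
    (hsum : ∑' i, p i ^ 2 = σ ^ 2) (n r s : ℕ) :
    |finiteCoeff p n s - schemeCoeff (fun s => virtualAlphabet p (elem s)) r s| *
        ∑' k, |poissonDiff lam s k| ≤
      (if s ∈ Finset.Icc 2 r then 4 * (s - 1) * (∑' i, p (n + i) ^ 2) * (2 * σ) ^ (s - 2) else 0) +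
        if r < s then (4 * √(Real.exp 1) * σ / √lam / 2) ^ s else 0 := by
  have hL : 0 ≤ ∑' k, |poissonDiff lam s k| := tsum_nonneg fun k => abs_nonneg _
  have hsq : ∑ i ∈ Finset.range n, p i ^ 2 ≤ σ ^ 2 :=
    hsum ▸ hs.sum_le_tsum _ fun i _ => sq_nonneg _
  by_cases h0 : s = 0
  · subst h0
    simp [finiteCoeff_zero, schemeCoeff]
  by_cases hmem : s ∈ Finset.Icc 2 r
  · obtain ⟨h2, hr⟩ := Finset.mem_Icc.mp hmem
    rw [schemeCoeff, if_neg h0, if_pos hmem, if_pos hmem, if_neg (by omega), add_zero]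
    obtain ⟨t, rfl⟩ := Nat.exists_eq_add_of_le' h2
    refine (mul_le_mul (abs_finiteCoeff_sub_le hp hs hσ.le hsum n t)
      (tsum_abs_poissonDiff_le_two_pow hl _) hL
      (mul_nonneg (mul_nonneg (by positivity) (tsum_nonneg fun i => sq_nonneg _))
        (by positivity))).trans (le_of_eq ?_)
    rw [Nat.add_sub_cancel, mul_pow]
    push_cast
    ring
  · rw [schemeCoeff, if_neg h0, if_neg hmem, if_neg hmem, sub_zero, zero_add]
    split_ifs with hr
    · exact abs_finiteCoeff_mul_le hp hσ hl hsq (Nat.one_le_iff_ne_zero.mpr h0)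
    · rw [Finset.mem_Icc] at hmem
      have h1 : s = 1 := by omega
      rw [h1, finiteCoeff_one, abs_zero, zero_mul]

end SymFun

theorem hasSum_geometric_tail {x : ℝ} (h0 : 0 ≤ x) (h1 : x < 1) (r : ℕ) :
    HasSum (fun s => if r < s then x ^ s else 0) (x ^ (r + 1) / (1 - x)) := by
  rw [← hasSum_nat_add_iff' (r + 1), Finset.sum_eq_zero fun s hs => ?_, sub_zero]
  · rw [div_eq_mul_inv]
    convert! (hasSum_geometric_of_lt_one h0 h1).mul_left (x ^ (r + 1)) using 2 with s
    rw [if_pos (by omega), ← pow_add, add_comm]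
  · rw [if_neg (by have := Finset.mem_range.mp hs; omega)]

open SymFun in
theorem dTV_derivedScheme_le {p : ℕ → ℝ} {σ : ℝ} (hp : ∀ i, 0 < p i ∧ p i < 1) (hσ : 0 ≤ σ)
    (hsum : HasSum (fun i => p i ^ 2) (σ ^ 2)) {n r : ℕ}
    (hlam : 16 * Real.exp 1 * σ ^ 2 < ∑ i ∈ Finset.range n, p i)
    {Ω : Type*} [MeasurableSpace Ω] {P : Measure Ω} [IsProbabilityMeasure P] {Y : Fin n → Ω → ℕ}
    (hY : ∀ i, HasLaw (Y i) (bernoulliMeasure 1 0 ⟨p i, (hp i).1.le, (hp i).2.le⟩) P)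
    (hind : iIndepFun Y P) {ν : SignedMeasure ℕ} (hν : IsDerivedScheme p n r ν) :
    dTV (P.map fun ω => ∑ i, Y i ω) ν ≤
      (4 * √(Real.exp 1) * σ / √(∑ i ∈ Finset.range n, p i)) ^ (r + 1) +
      ((r : ℝ) ^ 2 + (2 * (∑ i ∈ Finset.range n, p i) + 1) * r) *
        (∑ s ∈ Finset.Icc 2 r, (2 * σ) ^ (s - 2)) * ∑' i, p (n + i) ^ 2 := by
  have hp0 : ∀ i, 0 ≤ p i := fun i => (hp i).1.le
  -- `σ² ≥ p₀² > 0`.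
  have hσ0 : 0 < σ := by
    refine hσ.lt_of_ne fun h => ?_
    have h1 := le_hasSum hsum 0 fun i _ => sq_nonneg _
    have h2 := pow_pos (hp 0).1 2
    rw [← h] at h1
    norm_num at h1
    exact h2.ne' (by rw [h1]; norm_num)
  set lam := ∑ i ∈ Finset.range n, p i with hlam_def
  have hl : 0 < lam := lt_of_le_of_lt (by positivity) hlam
  set η := 4 * √(Real.exp 1) * σ / √lam with hη
  have hη0 : 0 ≤ η := by positivity
  -- The hypothesis on `lam` is `η² < 1`; it keeps the geometric ratio `η/2` below `1/2`.
  have hη1 : η < 1 := by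
    rw [hη, div_lt_one (Real.sqrt_pos.mpr hl)]
    refine Real.lt_sqrt_of_sq_lt ?_
    rw [mul_pow, mul_pow, Real.sq_sqrt (Real.exp_pos _).le]
    linarith
  set ρ := ∑' i, p (n + i) ^ 2 with hρ
  have hρ0 : 0 ≤ ρ := tsum_nonneg fun i => sq_nonneg _
  set b := fun s => virtualAlphabet p (elem s)
  have hc := summable_abs_finiteCoeff hp0 n
  have hc' := summable_abs_schemeCoeff b r
  have hcc : Summable fun s => |(finiteCoeff p n - schemeCoeff b r) s| * 2 ^ s :=
    (hc.add hc').of_nonneg_of_le (fun s => by positivity) fun s => by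
      rw [← add_mul]
      exact mul_le_mul_of_nonneg_right (abs_sub _ _) (by positivity)
  have hν' := (isPoissonScheme_iff hl b r ν).mp hν
  have hbound := (hasSum_sum_of_ne_finset_zero (s := Finset.Icc 2 r)
    (f := fun s : ℕ => if s ∈ Finset.Icc 2 r then 4 * ((s : ℝ) - 1) * ρ * (2 * σ) ^ (s - 2) else 0)
    fun s hs => if_neg hs).add (hasSum_geometric_tail (x := η / 2) (by positivity) (by linarith) r)
  have hmain : ∑' k, |(P.map fun ω => ∑ i, Y i ω).real {k} - ν {k}| ≤
      (∑ s ∈ Finset.Icc 2 r, 4 * ((s : ℝ) - 1) * ρ * (2 * σ) ^ (s - 2)) +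
        (η / 2) ^ (r + 1) / (1 - η / 2) := by
    have heq : ∀ k, (P.map fun ω => ∑ i, Y i ω).real {k} - ν {k} =
        poissonMixture lam (finiteCoeff p n - schemeCoeff b r) k := fun k => by
      rw [hν', real_map_sum_singleton hp hl hY hind, poissonMixture_sub hl hc hc']
    simp only [heq]
    refine (tsum_abs_poissonMixture_le hl hcc).trans ?_
    refine ((summable_abs_mul_tsum_abs_poissonDiff hl hcc).tsum_le_tsum
      (abs_finiteCoeff_sub_schemeCoeff_mul_le hp0 hsum.summable hσ0 hl hsum.tsum_eq n r)
      hbound.summable).trans (le_of_eq ?_)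
    rw [hbound.tsum_eq]
    congr 1
    exact Finset.sum_congr rfl fun s hs => if_pos hs
  -- As `1 - η/2 ≥ 1/2`, the geometric series costs a factor `2`, cancelled by the `1/2` of total
  -- variation.
  have htail : 1 / 2 * ((η / 2) ^ (r + 1) / (1 - η / 2)) ≤ η ^ (r + 1) := by
    have h1 : (η / 2) ^ (r + 1) ≤ η ^ (r + 1) :=
      pow_le_pow_left₀ (by positivity) (by linarith) _
    have h2 : (η / 2) ^ (r + 1) / (1 - η / 2) ≤ (η / 2) ^ (r + 1) / (1 / 2) := by
      gcongr
      linarith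
    linarith
  have hhead : 1 / 2 * ∑ s ∈ Finset.Icc 2 r, 4 * ((s : ℝ) - 1) * ρ * (2 * σ) ^ (s - 2) ≤
      ((r : ℝ) ^ 2 + (2 * lam + 1) * r) * (∑ s ∈ Finset.Icc 2 r, (2 * σ) ^ (s - 2)) * ρ := by
    rw [Finset.mul_sum, Finset.mul_sum, Finset.sum_mul]
    refine Finset.sum_le_sum fun s hs => ?_
    have hsr : (s : ℝ) ≤ r := by exact_mod_cast (Finset.mem_Icc.mp hs).2
    have hr0 : (0 : ℝ) ≤ r := Nat.cast_nonneg r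
    -- Already `2(s - 1) ≤ 2r - 2 ≤ r²`; the terms in `lam` and `r` are slack.
    have h1 : 2 * ((s : ℝ) - 1) ≤ (r : ℝ) ^ 2 + (2 * lam + 1) * r := by
      nlinarith [sq_nonneg ((r : ℝ) - 1), mul_nonneg hl.le hr0]
    have h2 : 0 ≤ (2 * σ) ^ (s - 2) * ρ := by positivity
    nlinarith [mul_le_mul_of_nonneg_right h1 h2]
  rw [dTV]
  linarith
theorem mainTheorem4 :
    ∃ C : ℝ, 0 < C ∧ C ≤ 570 ∧
      ∀ (p : ℕ → ℝ) (σ : ℝ) (hp : ∀ i, 0 < p i ∧ p i < 1), Antitone p →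
        0 ≤ σ → HasSum (fun i => p i ^ 2) (σ ^ 2) →
      ∀ (n r : ℕ), 1 ≤ r →
        16 * Real.exp 1 * σ ^ 2 < ∑ i ∈ Finset.range n, p i →
      ∀ (Ω : Type*) [MeasurableSpace Ω] (P : Measure Ω) [IsProbabilityMeasure P]
        (Y : Fin n → Ω → ℕ),
        (∀ i, HasLaw (Y i) (bernoulliMeasure 1 0 ⟨p i, (hp i).1.le, (hp i).2.le⟩) P) →
        iIndepFun Y P →
        (∃! ν : SignedMeasure ℕ, IsDerivedScheme p n r ν) ∧
        ∀ ν : SignedMeasure ℕ, IsDerivedScheme p n r ν →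
          dTV (P.map fun ω => ∑ i, Y i ω) ν ≤
            C * (4 * √(Real.exp 1) * σ / √(∑ i ∈ Finset.range n, p i)) ^ (r + 1) +
            ((r : ℝ) ^ 2 + (2 * (∑ i ∈ Finset.range n, p i) + 1) * r) *
              (∑ s ∈ Finset.Icc 2 r, (2 * σ) ^ (s - 2)) * ∑' i, p (n + i) ^ 2 := by
  -- The halved ratio `η/2` leaves enough room for `C = 1`.
  refine ⟨1, one_pos, by norm_num, fun p σ hp _ hσ hsum n r _ hlam Ω _ P _ Y hY hind => ?_⟩
  have hl : 0 < ∑ i ∈ Finset.range n, p i := lt_of_le_of_lt (by positivity) hlam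
  refine ⟨existsUnique_isPoissonScheme hl _ r, fun ν hν => ?_⟩
  rw [one_mul]
  exact dTV_derivedScheme_le hp hσ hsum hlam hY hind hν
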